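/- Let $G$ be a finite simple graph. For a vertex $v$ of $G$ let $N(v)$ be its open neighborhood and $N[v]=N(v)\cup\{v\}$ its closed neighborhood. In the Z-domination game on $G$ two players, Dominator and Staller, alternately choose vertices $v_1,v_2,\ldots$ of $G$, Dominator moving first; the choice of $v_i$ is legal if $N(v_i)\setminus\bigcup_{j=1}^{i-1}N[v_j]\neq\emptyset$, and the game ends when there is no legal move. Dominator wants the game to end with as few moves as possible, Staller with as many as possible. The game Z-domination number $\gamma_{Zg}(G)$ is the total number of moves played when both players play optimally. Let $P_n$ be the path on $n$ vertices. If $n\ge 2$, then $$\gamma_{Zg}(P_n)=\begin{cases}\left\lceil \frac n2\right\rceil-1, & n \bmod 4 = 3,\\[2pt] \left\lceil \frac n2\right\rceil, & \text{otherwise.}\end{cases}$$ -/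

import Mathlib

namespace DominationGame

/-- The two players: Dominator wants the game to end soon, Staller wants to delay the end. -/
inductive Player where
  | dominator
  | staller

/-- The player who moves next. -/
def Player.other : Player → Player
  | .dominator => .staller
  | .staller => .dominator

section

variable {V : Type*} [Fintype V] [DecidableEq V] (G : SimpleGraph V) [DecidableRel G.Adj]

/-- The closed neighborhood `N[v]`. -/
def closedNbhd (v : V) : Finset V := insert v (G.neighborFinset v)

/-- The legal moves of the Z-domination game when `D` is the union of the closed neighborhoods
of the vertices chosen so far: the vertices `v` with `N(v) \ D` nonempty. -/
def legalMovesZ (D : Finset V) : Finset V :=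
  Finset.univ.filter fun v => (G.neighborFinset v \ D).Nonempty

theorem card_compl_lt {D : Finset V} {v : V} (hv : v ∈ legalMovesZ G D) :
    (D ∪ closedNbhd G v)ᶜ.card < Dᶜ.card := by
  obtain ⟨w, hw⟩ := (Finset.mem_filter.1 hv).2
  rw [Finset.mem_sdiff] at hw
  apply Finset.card_lt_card
  rw [Finset.compl_ssubset_compl]
  refine ⟨Finset.subset_union_left, fun h => hw.2 (h ?_)⟩
  exact Finset.mem_union_right _ (Finset.mem_insert_of_mem hw.1)

/-- The number of moves still to be played in the Z-domination game on `G` when `D` is the union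
of the closed neighborhoods of the vertices chosen so far, player `p` is to move, and both
players play optimally. The game ends when there is no legal move. -/
def lengthZ (p : Player) (D : Finset V) : ℕ :=
  if h : (legalMovesZ G D).attach.Nonempty then
    match p with
    | .dominator =>
      1 + (legalMovesZ G D).attach.inf' h
        fun v => lengthZ Player.dominator.other (D ∪ closedNbhd G v.1)
    | .staller =>
      1 + (legalMovesZ G D).attach.sup' h
        fun v => lengthZ Player.staller.other (D ∪ closedNbhd G v.1)
  else 0
termination_by Dᶜ.card
decreasing_by all_goals exact card_compl_lt G v.2

/-- The game Z-domination number: Dominator moves first and no vertex is dominated yet. -/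
def gameZDominationNumber : ℕ := lengthZ G .dominator ∅

end

instance pathGraphDecidableAdj (n : ℕ) : DecidableRel (SimpleGraph.pathGraph n).Adj :=
  fun _ _ => decidable_of_iff _ SimpleGraph.pathGraph_adj.symm

end DominationGame

/-! Upper bound: let the weight of the undominated set be its size plus its number of runs of
consecutive vertices. Every legal move lowers the weight (`runWeight_undominatedAfter_lt`), and
Dominator can lower it by three as long as some run has two vertices
(`runWeight_undominatedAfter_add_three_le`). So two moves cost at least four, and the initial weight
`n + 1` allows at most `(n + 1) / 2` moves. For `n % 4 = 3` a separate induction saves one more move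
(`lengthZ_dominator_le_of_undominated_eq_Ico`).

Lower bound: Dominator's move dominates at most three new vertices, and Staller can answer with a
move that dominates only one (`exists_legalMovesZ_card_le`), so two moves dominate at most four
(`card_undominated_le`). -/

namespace DominationGame

/-! ### One-step bounds for the game length on any graph -/

section Length

variable {V : Type*} [Fintype V] [DecidableEq V] (G : SimpleGraph V) [DecidableRel G.Adj]

theorem lengthZ_eq_zero (p : Player) {D : Finset V} (h : legalMovesZ G D = ∅) :
    lengthZ G p D = 0 := by
  rw [lengthZ, dif_neg (by simp [h])]

theorem lengthZ_dominator_le {D : Finset V} {v : V} (hv : v ∈ legalMovesZ G D) :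
    lengthZ G .dominator D ≤ 1 + lengthZ G .staller (D ∪ closedNbhd G v) := by
  rw [lengthZ, dif_pos (by simpa using ⟨v, hv⟩)]
  exact Nat.add_le_add_left
    (Finset.inf'_le (fun w : legalMovesZ G D => lengthZ G .staller (D ∪ closedNbhd G w.1))
      (Finset.mem_attach _ ⟨v, hv⟩)) 1

theorem le_lengthZ_staller {D : Finset V} {v : V} (hv : v ∈ legalMovesZ G D) :
    1 + lengthZ G .dominator (D ∪ closedNbhd G v) ≤ lengthZ G .staller D := by
  rw [lengthZ.eq_def G .staller D, dif_pos (by simpa using ⟨v, hv⟩)]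
  exact Nat.add_le_add_left
    (Finset.le_sup' (fun w : legalMovesZ G D => lengthZ G .dominator (D ∪ closedNbhd G w.1))
      (Finset.mem_attach _ ⟨v, hv⟩)) 1

theorem exists_lengthZ_dominator_eq {D : Finset V} (h : (legalMovesZ G D).Nonempty) :
    ∃ v ∈ legalMovesZ G D,
      lengthZ G .dominator D = 1 + lengthZ G .staller (D ∪ closedNbhd G v) := by
  have h' : (legalMovesZ G D).attach.Nonempty := by simpa using h
  obtain ⟨v, -, hv⟩ := Finset.exists_mem_eq_inf' h'
    fun w : legalMovesZ G D => lengthZ G .staller (D ∪ closedNbhd G w.1)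
  refine ⟨v.1, v.2, ?_⟩
  rw [lengthZ, dif_pos h', ← hv]
  rfl

theorem exists_lengthZ_staller_eq {D : Finset V} (h : (legalMovesZ G D).Nonempty) :
    ∃ v ∈ legalMovesZ G D,
      lengthZ G .staller D = 1 + lengthZ G .dominator (D ∪ closedNbhd G v) := by
  have h' : (legalMovesZ G D).attach.Nonempty := by simpa using h
  obtain ⟨v, -, hv⟩ := Finset.exists_mem_eq_sup' h'
    fun w : legalMovesZ G D => lengthZ G .dominator (D ∪ closedNbhd G w.1)
  refine ⟨v.1, v.2, ?_⟩
  rw [lengthZ.eq_def G .staller D, dif_pos h', ← hv]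
  rfl

/-- Every move dominates a new vertex. -/
theorem lengthZ_le_card_compl (p : Player) (D : Finset V) : lengthZ G p D ≤ Dᶜ.card := by
  induction hk : Dᶜ.card using Nat.strong_induction_on generalizing p D with
  | _ k ih =>
    rcases (legalMovesZ G D).eq_empty_or_nonempty with h | h
    · simp [lengthZ_eq_zero G p h]
    · cases p
      · obtain ⟨v, hv, he⟩ := exists_lengthZ_dominator_eq G h
        have := ih _ (hk ▸ card_compl_lt G hv) .staller _ rfl
        have := card_compl_lt G hv
        omega
      · obtain ⟨v, hv, he⟩ := exists_lengthZ_staller_eq G h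
        have := ih _ (hk ▸ card_compl_lt G hv) .dominator _ rfl
        have := card_compl_lt G hv
        omega

end Length

/-! ### Runs of undominated vertices and their weight -/

section Runs

/-- What is left of the set `U` of undominated vertices of a path when `v` is chosen. -/
def undominatedAfter (U : Finset ℕ) (v : ℕ) : Finset ℕ := U.filter fun i => i + 1 < v ∨ v + 1 < i

/-- The last elements of the maximal runs of consecutive elements of `U`. -/
def runEnds (U : Finset ℕ) : Finset ℕ := U.filter fun i => i + 1 ∉ U

/-- The number of elements of `U` plus the number of maximal runs of consecutive elements. -/
def runWeight (U : Finset ℕ) : ℕ := U.card + (runEnds U).card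

theorem mem_undominatedAfter {U : Finset ℕ} {v i : ℕ} :
    i ∈ undominatedAfter U v ↔ i ∈ U ∧ (i + 1 < v ∨ v + 1 < i) := Finset.mem_filter

theorem mem_runEnds {U : Finset ℕ} {i : ℕ} : i ∈ runEnds U ↔ i ∈ U ∧ i + 1 ∉ U :=
  Finset.mem_filter

theorem card_undominatedAfter_add_le {U A : Finset ℕ} {v : ℕ} (hA : A ⊆ U)
    (hv : ∀ i ∈ A, v ≤ i + 1 ∧ i ≤ v + 1) : (undominatedAfter U v).card + A.card ≤ U.card := by
  rw [← Finset.card_union_of_disjoint]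
  · exact Finset.card_le_card (Finset.union_subset (Finset.filter_subset _ _) hA)
  · rw [Finset.disjoint_right]
    intro i hi h
    have := hv i hi
    have := (mem_undominatedAfter.1 h).2
    omega

theorem card_le_card_undominatedAfter_add_three (U : Finset ℕ) (v : ℕ) :
    U.card ≤ (undominatedAfter U v).card + 3 := by
  have h : U ⊆ undominatedAfter U v ∪ {v - 1, v, v + 1} := by
    intro i hi
    simp only [Finset.mem_union, mem_undominatedAfter, Finset.mem_insert, Finset.mem_singleton]
    have : (i + 1 < v ∨ v + 1 < i) ∨ i = v - 1 ∨ i = v ∨ i = v + 1 := by omega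
    tauto
  exact (Finset.card_le_card h).trans
    ((Finset.card_union_le _ _).trans (Nat.add_le_add_left Finset.card_le_three _))

/-- Removing `B` from the run ends, and adding the new run end `v - 2` if there is one. -/
theorem card_runEnds_undominatedAfter_add_le {U B : Finset ℕ} {v : ℕ} (hB : B ⊆ runEnds U)
    (hv : ∀ i ∈ B, v ≤ i + 1 ∧ i ≤ v + 1) :
    (runEnds (undominatedAfter U v)).card + B.card ≤ (runEnds U).card + 1 := by
  -- Only `v - 2` can lose its successor and survive. For `v < 2` the truncated value `0` is a
  -- harmless extra element.
  have h : runEnds (undominatedAfter U v) ⊆ insert (v - 2) (runEnds U \ B) := by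
    intro i hi
    simp only [mem_runEnds, mem_undominatedAfter, Finset.mem_insert, Finset.mem_sdiff] at hi ⊢
    by_cases hiv : i = v - 2
    · exact Or.inl hiv
    · refine Or.inr ⟨⟨hi.1.1, fun h => hi.2 ⟨h, by omega⟩⟩, fun h => ?_⟩
      have := hv i h
      omega
  have h₁ := (Finset.card_le_card h).trans (Finset.card_insert_le _ _)
  rw [Finset.card_sdiff_of_subset hB] at h₁
  have := Finset.card_le_card hB
  omega

/-- The same when no run is cut at its left. -/
theorem card_runEnds_undominatedAfter_add_le_of_not_mem {U B : Finset ℕ} {v : ℕ}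
    (hB : B ⊆ runEnds U) (hv : ∀ i ∈ B, v ≤ i + 1 ∧ i ≤ v + 1)
    (hU : ∀ i, i + 2 = v → i ∈ U → i + 1 ∉ U) :
    (runEnds (undominatedAfter U v)).card + B.card ≤ (runEnds U).card := by
  have h : runEnds (undominatedAfter U v) ⊆ runEnds U \ B := by
    intro i hi
    simp only [mem_runEnds, mem_undominatedAfter, Finset.mem_sdiff] at hi ⊢
    refine ⟨⟨hi.1.1, fun h => ?_⟩, fun h => ?_⟩
    · by_cases hiv : i + 2 = v
      · exact hU i hiv hi.1.1 h
      · exact hi.2 ⟨h, by omega⟩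
    · have := hv i h
      omega
  have h₁ := Finset.card_le_card h
  rw [Finset.card_sdiff_of_subset hB] at h₁
  have := Finset.card_le_card hB
  omega

/-- Choosing an undominated vertex that has an undominated neighbor. -/
theorem runWeight_undominatedAfter_add_two_le {U : Finset ℕ} {v w : ℕ} (hv : v ∈ U) (hw : w ∈ U)
    (hvw : w + 1 = v ∨ v + 1 = w) : runWeight (undominatedAfter U v) + 2 ≤ runWeight U := by
  unfold runWeight
  have h2 := card_undominatedAfter_add_le (U := U) (A := {v, w}) (v := v)
    (by simp [Finset.insert_subset_iff, hv, hw]) (by simp; omega)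
  rw [Finset.card_pair (by omega)] at h2
  by_cases hU : ∀ i, i + 2 = v → i ∈ U → i + 1 ∉ U
  · have := card_runEnds_undominatedAfter_add_le_of_not_mem (U := U) (B := ∅) (v := v)
      (by simp) (by simp) hU
    simp only [Finset.card_empty] at this
    omega
  · push Not at hU
    obtain ⟨i, rfl, hi, hi'⟩ := hU
    -- The cut may create the run end `i`. This is paid for by a third removed vertex, or by the
    -- removal of the old run end `i + 2`.
    by_cases hs : i + 3 ∈ U
    · have h3 := card_undominatedAfter_add_le (U := U) (A := {i + 1, i + 2, i + 3}) (v := i + 2)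
        (by simp [Finset.insert_subset_iff, hi', hv, hs]) (by simp)
      have hc : ({i + 1, i + 2, i + 3} : Finset ℕ).card = 3 := by
        rw [Finset.card_eq_three]
        exact ⟨i + 1, i + 2, i + 3, by omega, by omega, by omega, rfl⟩
      have := card_runEnds_undominatedAfter_add_le (U := U) (B := ∅) (v := i + 2)
        (by simp) (by simp)
      simp only [Finset.card_empty] at this
      omega
    · have := card_runEnds_undominatedAfter_add_le (U := U) (B := {i + 2}) (v := i + 2)
        (by simp [mem_runEnds, hv, hs]) (by simp)
      simp only [Finset.card_singleton] at this
      omega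

/-- If `v` is already dominated, a run on its left is only shortened: its end moves from `v - 1` to
`v - 2`, so no run is added. -/
theorem runWeight_undominatedAfter_lt {U : Finset ℕ} {v w : ℕ} (hw : w ∈ U)
    (hvw : w + 1 = v ∨ v + 1 = w) : runWeight (undominatedAfter U v) < runWeight U := by
  by_cases hv : v ∈ U
  · have := runWeight_undominatedAfter_add_two_le hv hw hvw
    omega
  unfold runWeight
  have h1 := card_undominatedAfter_add_le (U := U) (A := {w}) (v := v)
    (by simpa using hw) (by simp; omega)
  rw [Finset.card_singleton] at h1
  by_cases hU : ∀ i, i + 2 = v → i ∈ U → i + 1 ∉ U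
  · have := card_runEnds_undominatedAfter_add_le_of_not_mem (U := U) (B := ∅) (v := v)
      (by simp) (by simp) hU
    simp only [Finset.card_empty] at this
    omega
  · push Not at hU
    obtain ⟨i, rfl, hi, hi'⟩ := hU
    have := card_runEnds_undominatedAfter_add_le (U := U) (B := {i + 1}) (v := i + 2)
      (by simp [mem_runEnds, hi', hv]) (by simp)
    simp only [Finset.card_singleton] at this
    omega

/-- Choosing the second vertex of a run. -/
theorem runWeight_undominatedAfter_add_three_le {U : Finset ℕ} {i : ℕ} (hi : i ∈ U)
    (hi' : i + 1 ∈ U) (hU : ∀ j ∈ U, j + 1 ≠ i) :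
    runWeight (undominatedAfter U (i + 1)) + 3 ≤ runWeight U := by
  unfold runWeight
  have hU' : ∀ j, j + 2 = i + 1 → j ∈ U → j + 1 ∉ U := fun j hj hjU =>
    absurd (by omega) (hU j hjU)
  by_cases hs : i + 2 ∈ U
  · have h3 := card_undominatedAfter_add_le (U := U) (A := {i, i + 1, i + 2}) (v := i + 1)
      (by simp [Finset.insert_subset_iff, hi', hi, hs]) (by simp; omega)
    have hc : ({i, i + 1, i + 2} : Finset ℕ).card = 3 := by
      rw [Finset.card_eq_three]
      exact ⟨i, i + 1, i + 2, by omega, by omega, by omega, rfl⟩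
    have := card_runEnds_undominatedAfter_add_le_of_not_mem (U := U) (B := ∅) (v := i + 1)
      (by simp) (by simp) hU'
    simp only [Finset.card_empty] at this
    omega
  · have h2 := card_undominatedAfter_add_le (U := U) (A := {i, i + 1}) (v := i + 1)
      (by simp [Finset.insert_subset_iff, hi', hi]) (by simp; omega)
    rw [Finset.card_pair (by omega)] at h2
    have := card_runEnds_undominatedAfter_add_le_of_not_mem (U := U) (B := {i + 1}) (v := i + 1)
      (by simp [mem_runEnds, hi', hs]) (by simp) hU'
    simp only [Finset.card_singleton] at this
    omega

/-- The least such `i` starts a run, since a predecessor in `U` would be a smaller witness. -/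
theorem exists_run_start {U : Finset ℕ} (h : ∃ i ∈ U, i + 1 ∈ U) :
    ∃ i ∈ U, i + 1 ∈ U ∧ ∀ j ∈ U, j + 1 ≠ i := by
  classical
  obtain ⟨h₁, h₂⟩ := Nat.find_spec h
  refine ⟨Nat.find h, h₁, h₂, fun j hj hji => ?_⟩
  exact Nat.find_min h (m := j) (by omega) ⟨hj, by rwa [hji]⟩

theorem runWeight_of_isolated {U : Finset ℕ} (h : ¬∃ i ∈ U, i + 1 ∈ U) :
    runWeight U = 2 * U.card := by
  have : runEnds U = U := Finset.filter_true_of_mem fun i hi hi' => h ⟨i, hi, hi'⟩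
  rw [runWeight, this]
  omega

theorem runWeight_Ico {a n : ℕ} (h : a < n) : runWeight (Finset.Ico a n) = n - a + 1 := by
  have : runEnds (Finset.Ico a n) = {n - 1} := by
    ext i
    simp only [mem_runEnds, Finset.mem_Ico, Finset.mem_singleton]
    omega
  rw [runWeight, this, Nat.card_Ico, Finset.card_singleton]

end Runs

/-! ### Strategies of both players on the path -/

section Path

variable {n : ℕ}

/-- The undominated vertices of the path, as natural numbers. -/
def undominated (D : Finset (Fin n)) : Finset ℕ := Dᶜ.map Fin.valEmbedding

theorem mem_undominated {D : Finset (Fin n)} {i : ℕ} :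
    i ∈ undominated D ↔ ∃ h : i < n, (⟨i, h⟩ : Fin n) ∉ D := by
  simp only [undominated, Finset.mem_map, Finset.mem_compl, Fin.valEmbedding_apply]
  constructor
  · rintro ⟨a, ha, rfl⟩
    exact ⟨a.2, ha⟩
  · rintro ⟨h, hi⟩
    exact ⟨_, hi, rfl⟩

theorem undominated_empty : undominated (∅ : Finset (Fin n)) = Finset.Ico 0 n := by
  ext i
  simp [mem_undominated]

theorem card_undominated (D : Finset (Fin n)) : (undominated D).card = Dᶜ.card :=
  Finset.card_map _

theorem undominated_union_closedNbhd (D : Finset (Fin n)) (v : Fin n) :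
    undominated (D ∪ closedNbhd (SimpleGraph.pathGraph n) v) =
      undominatedAfter (undominated D) v := by
  ext i
  simp only [mem_undominated, mem_undominatedAfter, closedNbhd, Finset.mem_union,
    Finset.mem_insert, SimpleGraph.mem_neighborFinset, SimpleGraph.pathGraph_adj, Fin.ext_iff,
    not_or]
  constructor
  · rintro ⟨h, hi, h'⟩
    exact ⟨⟨h, hi⟩, by omega⟩
  · rintro ⟨⟨h, hi⟩, h'⟩
    exact ⟨h, hi, by omega⟩

theorem mem_legalMovesZ_path {D : Finset (Fin n)} {v : Fin n} :
    v ∈ legalMovesZ (SimpleGraph.pathGraph n) D ↔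
      ∃ w ∈ undominated D, w + 1 = v ∨ (v : ℕ) + 1 = w := by
  simp only [legalMovesZ, Finset.mem_filter, Finset.mem_univ, true_and, Finset.Nonempty,
    Finset.mem_sdiff, SimpleGraph.mem_neighborFinset, SimpleGraph.pathGraph_adj, mem_undominated]
  constructor
  · rintro ⟨w, hvw, hw⟩
    exact ⟨w, ⟨w.2, hw⟩, hvw.symm⟩
  · rintro ⟨w, ⟨h, hw⟩, hvw⟩
    exact ⟨⟨w, h⟩, hvw.symm, hw⟩

theorem legalMovesZ_path_nonempty (hn : 2 ≤ n) {D : Finset (Fin n)}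
    (h : (undominated D).Nonempty) : (legalMovesZ (SimpleGraph.pathGraph n) D).Nonempty := by
  obtain ⟨w, hw⟩ := h
  obtain ⟨hwn, -⟩ := mem_undominated.1 hw
  by_cases h0 : w = 0
  · exact ⟨⟨1, hn⟩, mem_legalMovesZ_path.2 ⟨w, hw, Or.inl (by simp [h0])⟩⟩
  · exact ⟨⟨w - 1, by omega⟩, mem_legalMovesZ_path.2 ⟨w, hw, Or.inr (by simp; omega)⟩⟩

/-- Dominator can halve the run weight: he chooses the second vertex of a run. -/
theorem two_mul_lengthZ_dominator_le (D : Finset (Fin n)) :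
    2 * lengthZ (SimpleGraph.pathGraph n) .dominator D ≤ runWeight (undominated D) := by
  induction hk : Dᶜ.card using Nat.strong_induction_on generalizing D with
  | _ k ih =>
    by_cases h : ∃ i ∈ undominated D, i + 1 ∈ undominated D
    · obtain ⟨i, hi, hi', hU⟩ := exists_run_start h
      obtain ⟨hin, -⟩ := mem_undominated.1 hi'
      set v : Fin n := ⟨i + 1, hin⟩
      have hv : v ∈ legalMovesZ (SimpleGraph.pathGraph n) D :=
        mem_legalMovesZ_path.2 ⟨i, hi, Or.inl rfl⟩
      have h₁ := lengthZ_dominator_le _ hv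
      have h₂ := runWeight_undominatedAfter_add_three_le hi hi' hU
      rw [← show undominated (D ∪ closedNbhd (SimpleGraph.pathGraph n) v) =
        undominatedAfter (undominated D) (i + 1) from undominated_union_closedNbhd D v] at h₂
      have hc := card_compl_lt _ hv
      set D' := D ∪ closedNbhd (SimpleGraph.pathGraph n) v
      rcases (legalMovesZ (SimpleGraph.pathGraph n) D').eq_empty_or_nonempty with he | he
      · rw [lengthZ_eq_zero _ _ he] at h₁
        omega
      · obtain ⟨w, hw, hl⟩ := exists_lengthZ_staller_eq _ he
        have h₃ := ih _ (by have := card_compl_lt _ hw; omega)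
          (D' ∪ closedNbhd (SimpleGraph.pathGraph n) w) rfl
        obtain ⟨x, hx, hxw⟩ := mem_legalMovesZ_path.1 hw
        have h₄ := runWeight_undominatedAfter_lt hx hxw
        rw [← undominated_union_closedNbhd] at h₄
        omega
    -- All runs are single vertices, so the weight is twice the size and the trivial bound of one
    -- new vertex per move suffices.
    · rw [runWeight_of_isolated h, card_undominated]
      exact Nat.mul_le_mul_left 2 (lengthZ_le_card_compl _ _ _)

/-- If the undominated vertices form a final segment of length `4 * k + 3`, then Dominator saves
one more move. -/
theorem lengthZ_dominator_le_of_undominated_eq_Ico (k a : ℕ) {D : Finset (Fin n)}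
    (hD : undominated D = Finset.Ico a n) (hn : n = a + (4 * k + 3)) :
    lengthZ (SimpleGraph.pathGraph n) .dominator D ≤ 2 * k + 1 := by
  induction k generalizing a D with
  | zero =>
    set v : Fin n := ⟨a + 1, by omega⟩
    have hv : v ∈ legalMovesZ (SimpleGraph.pathGraph n) D :=
      mem_legalMovesZ_path.2 ⟨a, by rw [hD, Finset.mem_Ico]; omega, Or.inl rfl⟩
    refine (lengthZ_dominator_le _ hv).trans ?_
    rw [lengthZ_eq_zero]
    rw [Finset.eq_empty_iff_forall_notMem]
    intro w hw
    obtain ⟨x, hx, -⟩ := mem_legalMovesZ_path.1 hw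
    rw [undominated_union_closedNbhd, mem_undominatedAfter, hD, Finset.mem_Ico] at hx
    simp only [v] at hx
    omega
  | succ k ih =>
    set v : Fin n := ⟨a + 1, by omega⟩
    have hv : v ∈ legalMovesZ (SimpleGraph.pathGraph n) D :=
      mem_legalMovesZ_path.2 ⟨a, by rw [hD, Finset.mem_Ico]; omega, Or.inl rfl⟩
    have h₁ := lengthZ_dominator_le _ hv
    have hD' : undominated (D ∪ closedNbhd (SimpleGraph.pathGraph n) v) =
        Finset.Ico (a + 3) n := by
      rw [undominated_union_closedNbhd, hD]
      ext i
      simp only [mem_undominatedAfter, Finset.mem_Ico, v]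
      omega
    set D' := D ∪ closedNbhd (SimpleGraph.pathGraph n) v
    rcases (legalMovesZ (SimpleGraph.pathGraph n) D').eq_empty_or_nonempty with he | he
    · rw [lengthZ_eq_zero _ _ he] at h₁
      omega
    · obtain ⟨w, hw, hl⟩ := exists_lengthZ_staller_eq _ he
      suffices lengthZ (SimpleGraph.pathGraph n)
          .dominator (D' ∪ closedNbhd (SimpleGraph.pathGraph n) w) ≤ 2 * k + 1 by
        omega
      obtain ⟨x, hx, hxw⟩ := mem_legalMovesZ_path.1 hw
      have hwn := w.2
      -- An undominated `w` lowers the weight from `4 * k + 5` to at most `4 * k + 3`, whose half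
      -- rounds down to `2 * k + 1`. A dominated `w` can only be `a + 2`, which leaves a final
      -- segment of length `4 * k + 3`.
      by_cases hwD : (w : ℕ) ∈ undominated D'
      · have h₄ := runWeight_undominatedAfter_add_two_le hwD hx hxw
        rw [← undominated_union_closedNbhd, hD', runWeight_Ico (by omega)] at h₄
        have := two_mul_lengthZ_dominator_le (D' ∪ closedNbhd (SimpleGraph.pathGraph n) w)
        omega
      · refine ih (a + 4) ?_ (by omega)
        rw [undominated_union_closedNbhd, hD']
        rw [hD', Finset.mem_Ico] at hwD hx
        ext i
        simp only [mem_undominatedAfter, Finset.mem_Ico]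
        omega

/-- No single element is missing between two elements of `U`. -/
def NoSingleGap (U : Finset ℕ) : Prop := ∀ i ∈ U, i + 2 ∈ U → i + 1 ∈ U

/-- A move deletes a block of three consecutive positions, and deleting `i + 1` that way also
deletes `i` or `i + 2`. -/
theorem NoSingleGap.undominatedAfter {U : Finset ℕ} (h : NoSingleGap U) (v : ℕ) :
    NoSingleGap (undominatedAfter U v) := by
  intro i hi hi'
  rw [mem_undominatedAfter] at *
  exact ⟨h i hi.1 hi'.1, by omega⟩

/-- If some but not all vertices are dominated, Staller can dominate exactly one new vertex. -/
theorem exists_legalMovesZ_card_le {D : Finset (Fin n)} (hD : D.Nonempty)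
    (hU : (undominated D).Nonempty) (hgap : NoSingleGap (undominated D)) :
    ∃ v ∈ legalMovesZ (SimpleGraph.pathGraph n) D,
      (undominated D).card ≤ (undominatedAfter (undominated D) v).card + 1 := by
  -- Staller plays a dominated `v` next to an undominated `w`. A second new vertex would lie on the
  -- other side of `v`, making `v` a single gap.
  have key : ∃ (v : Fin n) (w : ℕ), (v : ℕ) ∉ undominated D ∧ w ∈ undominated D ∧
      (w + 1 = v ∨ (v : ℕ) + 1 = w) := by
    by_contra! hcon
    have step : ∀ i, i + 1 < n → (i ∈ undominated D ↔ i + 1 ∈ undominated D) := by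
      intro i hi
      constructor
      · intro h
        by_contra h'
        exact (hcon ⟨i + 1, hi⟩ i h' h).1 rfl
      · intro h
        by_contra h'
        exact (hcon ⟨i, by omega⟩ (i + 1) h' h).2 rfl
    have all : ∀ i < n, (i ∈ undominated D ↔ 0 ∈ undominated D) := by
      intro i
      induction i with
      | zero => exact fun _ => Iff.rfl
      | succ i ih => exact fun hi => (step i hi).symm.trans (ih (by omega))
    obtain ⟨d, hd⟩ := hD
    obtain ⟨u, hu⟩ := hU
    have hd' := (all d d.2).2 ((all u (mem_undominated.1 hu).1).1 hu)
    exact (mem_undominated.1 hd').2 hd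
  obtain ⟨v, w, hv, hw, hvw⟩ := key
  refine ⟨v, mem_legalMovesZ_path.2 ⟨w, hw, hvw⟩, ?_⟩
  have h : undominated D ⊆ insert w (undominatedAfter (undominated D) v) := by
    intro i hi
    rw [Finset.mem_insert, mem_undominatedAfter]
    by_contra! hcon
    obtain ⟨hne, hi'⟩ := hcon
    have hi' := hi' hi
    have hiv : i ≠ v := fun h => hv (h ▸ hi)
    rcases hvw with hvw | hvw
    · refine hv (hvw ▸ hgap w hw ?_)
      rwa [show w + 2 = i by omega]
    · have hiv' : i + 1 = v := by omega
      refine hv (hiv' ▸ hgap i hi ?_)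
      rwa [show i + 2 = w by omega]
  exact (Finset.card_le_card h).trans (Finset.card_insert_le _ _)

/-- Each pair of moves accounts for four vertices. The parity term is for an odd last move of
Dominator, which may dominate three vertices rather than two. -/
theorem card_undominated_le (hn : 2 ≤ n) (D : Finset (Fin n))
    (hgap : NoSingleGap (undominated D)) :
    (undominated D).card ≤ 2 * lengthZ (SimpleGraph.pathGraph n) .dominator D +
      lengthZ (SimpleGraph.pathGraph n) .dominator D % 2 := by
  induction hk : Dᶜ.card using Nat.strong_induction_on generalizing D with
  | _ k ih =>
    rcases (undominated D).eq_empty_or_nonempty with hU | hU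
    · simp [hU]
    obtain ⟨v, hv, h₁⟩ := exists_lengthZ_dominator_eq _ (legalMovesZ_path_nonempty hn hU)
    have h₂ := card_le_card_undominatedAfter_add_three (undominated D) v
    have hgap' := hgap.undominatedAfter v
    rw [← undominated_union_closedNbhd] at h₂ hgap'
    have hc := card_compl_lt _ hv
    have hne : (D ∪ closedNbhd (SimpleGraph.pathGraph n) v).Nonempty :=
      ⟨v, Finset.mem_union_right _ (Finset.mem_insert_self _ _)⟩
    set D' := D ∪ closedNbhd (SimpleGraph.pathGraph n) v
    rcases (undominated D').eq_empty_or_nonempty with hU' | hU'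
    · rw [hU', Finset.card_empty] at h₂
      omega
    obtain ⟨w, hw, h₃⟩ := exists_legalMovesZ_card_le hne hU' hgap'
    have hgap'' := hgap'.undominatedAfter w
    rw [← undominated_union_closedNbhd] at h₃ hgap''
    have h₄ := le_lengthZ_staller _ hw
    have h₅ := ih _ (by have := card_compl_lt _ hw; omega) _ hgap'' rfl
    omega

end Path

theorem gameZDominationNumber_pathGraph (n : ℕ) (hn : 2 ≤ n) :
    gameZDominationNumber (SimpleGraph.pathGraph n) =
      if n % 4 = 3 then (n + 1) / 2 - 1 else (n + 1) / 2 := by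
  unfold gameZDominationNumber
  have hgap : NoSingleGap (undominated (∅ : Finset (Fin n))) := by
    intro i hi hi'
    rw [undominated_empty, Finset.mem_Ico] at *
    omega
  have h₁ := card_undominated_le hn ∅ hgap
  have h₂ := two_mul_lengthZ_dominator_le (∅ : Finset (Fin n))
  rw [undominated_empty] at h₁ h₂
  rw [Nat.card_Ico] at h₁
  rw [runWeight_Ico (by omega)] at h₂
  split_ifs with h
  · have := lengthZ_dominator_le_of_undominated_eq_Ico (n / 4) 0 undominated_empty
      (show n = 0 + (4 * (n / 4) + 3) by omega)
    omega
  · omega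

end DominationGame

theorem ceil_natCast_div_two (n : ℕ) : ⌈(n : ℚ) / 2⌉ = (((n + 1) / 2 : ℕ) : ℤ) := by
  rw [Int.ceil_eq_iff]
  have h : n ≤ 2 * ((n + 1) / 2) ∧ 2 * ((n + 1) / 2) ≤ n + 1 := by omega
  generalize (n + 1) / 2 = m at h
  have h₁ : (n : ℚ) ≤ 2 * m := by exact_mod_cast h.1
  have h₂ : (2 : ℚ) * m ≤ n + 1 := by exact_mod_cast h.2
  push_cast
  constructor <;> linarith

theorem mainTheorem6 (n : ℕ) (hn : 2 ≤ n) :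
    (DominationGame.gameZDominationNumber (SimpleGraph.pathGraph n) : ℤ) =
      if n % 4 = 3 then ⌈(n : ℚ) / 2⌉ - 1 else ⌈(n : ℚ) / 2⌉ := by
  rw [DominationGame.gameZDominationNumber_pathGraph n hn, ceil_natCast_div_two]
  split_ifs <;> omega
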